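/- Let $N\in\mathbb N$ and $p,q,r\in\mathbb R$ satisfy $1\le p<N$ and $p^*\le r<q<\infty$, where $p^*=\frac{Np}{N-p}$. Let $K,V:\mathbb R^N\to(0,\infty)$ be Lebesgue measurable functions such that - $K\in L^\alpha_{loc}(\mathbb R^N)$ for some $\alpha\in\left(\frac{q}{q-r},\infty\right]$; - for every compact set $D\subset\mathbb R^N$ there is a constant $V_D>0$ with $V(x)\ge V_D$ for all $x\in D$; - $K^{\frac{q}{q-r}}V^{-\frac{r}{q-r}}\in L^1(\mathbb R^N)$. For $s\geq 1$ and a measurable weight $W>0$, let $L^s_W(\mathbb R^N)$ be the space of all real-valued $u\in L^1_{loc}(\mathbb R^N)$ with $\|u\|_{L^s_W}=\left(\int_{\mathbb R^N}|u|^sW\,dx\right)^{1/s}<\infty$. Let $M^{1,p,q}_V(\mathbb R^N)$ be the space of all real-valued $u\in L^{p^*}(\mathbb R^N)$ that have a weak gradient $\nabla u$ with $|\nabla u|\in L^p(\mathbb R^N)$ and that satisfy $\|u\|_{M^{1,p,q}_V}=\|u\|_{L^q_V}+\||\nabla u|\|_{L^p}<\infty$. Then $M^{1,p,q}_V(\mathbb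 R^N)$ embeds compactly into $L^r_K(\mathbb R^N)$. That is, $M^{1,p,q}_V(\mathbb R^N)\subseteq L^r_K(\mathbb R^N)$; there is a constant $C<\infty$ with $\|u\|_{L^r_K}\le C\|u\|_{M^{1,p,q}_V}$ for all $u\in M^{1,p,q}_V(\mathbb R^N)$; and every sequence that is bounded in $M^{1,p,q}_V(\mathbb R^N)$ has a subsequence that converges in $L^r_K(\mathbb R^N)$ to an element of $L^r_K(\mathbb R^N)$. -/

import Mathlib

open MeasureTheory Filter Topology
open scoped ENNReal NNReal ContDiff

/-- `g` is the weak (distributional) gradient of `u` on `ℝ^N`: both are locally integrable and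
`∫ u ∂ᵢφ = - ∫ gᵢ φ` for every smooth compactly supported `φ` and every coordinate `i`. -/
structure HasWeakGradient {N : ℕ} (u : EuclideanSpace ℝ (Fin N) → ℝ)
    (g : EuclideanSpace ℝ (Fin N) → EuclideanSpace ℝ (Fin N)) : Prop where
  locallyIntegrable : LocallyIntegrable u volume
  locallyIntegrable_grad : LocallyIntegrable g volume
  integral_eq : ∀ φ : EuclideanSpace ℝ (Fin N) → ℝ, ContDiff ℝ ∞ φ → HasCompactSupport φ →
    ∀ i : Fin N, ∫ x, u x * fderiv ℝ φ x (EuclideanSpace.single i 1) = - ∫ x, g x i * φ x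

/-- The weak gradient is unique up to a null set. -/
theorem HasWeakGradient.ae_eq {N : ℕ} {u : EuclideanSpace ℝ (Fin N) → ℝ}
    {g h : EuclideanSpace ℝ (Fin N) → EuclideanSpace ℝ (Fin N)}
    (hg : HasWeakGradient u g) (hh : HasWeakGradient u h) : g =ᵐ[volume] h := by
  have hc : ∀ {f : EuclideanSpace ℝ (Fin N) → EuclideanSpace ℝ (Fin N)},
      LocallyIntegrable f volume → ∀ i, LocallyIntegrable (fun x => f x i) volume := by
    intro f hf i
    refine hf.mono (((EuclideanSpace.proj (𝕜 := ℝ) i).continuous).comp_aestronglyMeasurable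
      hf.aestronglyMeasurable) (Eventually.of_forall fun x => ?_)
    exact PiLp.norm_apply_le (f x) i
  have key : ∀ i, ∀ᵐ x, g x i = h x i := by
    intro i
    refine ae_eq_of_integral_contDiff_smul_eq (hc hg.locallyIntegrable_grad i)
      (hc hh.locallyIntegrable_grad i) ?_
    intro φ hφ hφc
    have h1 := hg.integral_eq φ hφ hφc i
    have h2 := hh.integral_eq φ hφ hφc i
    simp only [smul_eq_mul, mul_comm (φ _)]
    linarith
  filter_upwards [ae_all_iff.2 key] with x hx
  ext i
  exact hx i

open Classical in
/-- A representative of the weak gradient of `u` (and `0` if `u` has none). -/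
noncomputable def weakGradient {N : ℕ} (u : EuclideanSpace ℝ (Fin N) → ℝ) :
    EuclideanSpace ℝ (Fin N) → EuclideanSpace ℝ (Fin N) :=
  if h : ∃ g, HasWeakGradient u g then h.choose else 0

/-- The Sobolev critical exponent `p* = N p / (N - p)` (for `p < N`). -/
noncomputable def sobolevCritical (N : ℕ) (p : ℝ) : ℝ := N * p / (N - p)

/-- The weighted norm `(∫ |u|^s W dx)^(1/s)`, with value `∞` allowed. -/
noncomputable def weightedNorm {N : ℕ} (s : ℝ) (W : EuclideanSpace ℝ (Fin N) → ℝ)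
    (u : EuclideanSpace ℝ (Fin N) → ℝ) : ℝ≥0∞ :=
  (∫⁻ x, ENNReal.ofReal (|u x| ^ s * W x)) ^ (1 / s)

/-- The weighted space `L^s_W(ℝ^N)`: all `u ∈ L¹_loc` with `∫ |u|^s W dx < ∞`. -/
def weightedLp {N : ℕ} (s : ℝ) (W : EuclideanSpace ℝ (Fin N) → ℝ) :
    Set (EuclideanSpace ℝ (Fin N) → ℝ) :=
  {u | LocallyIntegrable u volume ∧ weightedNorm s W u < (⊤ : ℝ≥0∞)}

/-- The space `D^{1,p}(ℝ^N)`, `1 ≤ p < N`: all `u ∈ L^{p*}` with a weak gradient in `L^p`. -/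
def homogeneousSobolev (N : ℕ) (p : ℝ) : Set (EuclideanSpace ℝ (Fin N) → ℝ) :=
  {u | MemLp u (ENNReal.ofReal (sobolevCritical N p)) volume ∧
    ∃ g, HasWeakGradient u g ∧ MemLp g (ENNReal.ofReal p) volume}

/-- The norm `‖u‖_{L^q_V} + ‖|∇u|‖_p`. -/
noncomputable def sobolevMNorm {N : ℕ} (p q : ℝ) (V : EuclideanSpace ℝ (Fin N) → ℝ)
    (u : EuclideanSpace ℝ (Fin N) → ℝ) : ℝ≥0∞ :=
  weightedNorm q V u + eLpNorm (weakGradient u) (ENNReal.ofReal p) volume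

/-- The space `M^{1,p,q}_V(ℝ^N)`, `1 ≤ p < N`: all `u ∈ D^{1,p}(ℝ^N)` that lie in `L^q_V(ℝ^N)`
(the norm `sobolevMNorm p q V u` is then finite). -/
def sobolevM {N : ℕ} (p q : ℝ) (V : EuclideanSpace ℝ (Fin N) → ℝ) :
    Set (EuclideanSpace ℝ (Fin N) → ℝ) :=
  {u | u ∈ homogeneousSobolev N p ∧ u ∈ weightedLp q V}

/-- `X`, normed by `nX`, embeds compactly into `Y`, normed by `nY`: `X ⊆ Y`, the inclusion is
bounded, and every `nX`-bounded sequence in `X` has a subsequence that converges in `Y`. -/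
structure IsCompactEmbedding {Ω : Type*} (X : Set (Ω → ℝ)) (nX : (Ω → ℝ) → ℝ≥0∞)
    (Y : Set (Ω → ℝ)) (nY : (Ω → ℝ) → ℝ≥0∞) : Prop where
  subset : X ⊆ Y
  bounded : ∃ C : ℝ≥0, ∀ u ∈ X, nY u ≤ C * nX u
  compact : ∀ u : ℕ → Ω → ℝ, (∀ n, u n ∈ X) → (∃ C : ℝ≥0, ∀ n, nX (u n) ≤ C) →
    ∃ w ∈ Y, ∃ k : ℕ → ℕ, StrictMono k ∧
      Tendsto (fun n => nY (fun x => u (k n) x - w x)) atTop (𝓝 0)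

/-! Split `K|u|^r = (|u|^q V)^(r/q) * (K V^(-r/q))`. The exponents `q/r` and `q/(q-r)` are
conjugate, and the `q/(q-r)`-th power of the second factor is exactly the weight assumed integrable,
so Hölder's inequality gives the bounded inclusion (`weightedNorm_le_mul_weightedNorm`).

For compactness, apply the splitting to `u n - w`. The first factor is bounded in `L^(q/r)` and the
second is a fixed element of the dual space, so convergence a.e. already forces the integral of the
product to `0` (`tendsto_lintegral_mul_zero_of_bounded`). It remains to find a subsequence
converging a.e.; by Fatou its limit satisfies the same `L^q_V` bound.

That subsequence comes from a Rellich argument in `L¹` of balls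
(`exists_subseq_ae_tendsto_of_hasWeakGradient`). The lower bounds on `V` and the `L^p` bound on
gradients give `L¹` bounds on every ball. Mollification at scale `δ` moves each function by at most
`δ` times the `L¹` norm of its gradient on a larger ball, uniformly along the sequence. At a fixed
scale the mollified functions are locally equibounded and equi-Lipschitz, so a subsequence converges
pointwise at all scales at once. -/

/-! ### Translations and averages over balls. -/

theorem enorm_sub_le_lintegral_fderiv {E : Type*} [NormedAddCommGroup E] [NormedSpace ℝ E]
    {v : E → ℝ} (hv : ContDiff ℝ 1 v) (x y : E) :
    ‖v (x - y) - v x‖ₑ ≤ ‖y‖ₑ * ∫⁻ s in Set.Icc (0 : ℝ) 1, ‖fderiv ℝ v (x - s • y)‖ₑ := by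
  have hd : ∀ s : ℝ, HasDerivAt (fun s : ℝ => v (x - s • y)) (fderiv ℝ v (x - s • y) (-y)) s := by
    intro s
    have h1 : HasDerivAt (fun s : ℝ => x - s • y) (-y) s := by
      simpa using ((hasDerivAt_id s).smul_const y).const_sub x
    exact ((hv.differentiable one_ne_zero) _).hasFDerivAt.comp_hasDerivAt s h1
  have hc : ContDiff ℝ 1 (fun s : ℝ => v (x - s • y)) := by fun_prop
  have := enorm_sub_le_lintegral_deriv_of_contDiffOn_Icc hc.contDiffOn (zero_le_one (α := ℝ))
  simp only [one_smul, zero_smul, sub_zero] at this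
  refine this.trans ?_
  rw [← lintegral_const_mul' _ _ enorm_ne_top]
  refine lintegral_mono fun s => ?_
  rw [(hd s).deriv, mul_comm]
  simpa using (fderiv ℝ v (x - s • y)).le_opENorm (-y)

section Translation

variable {E : Type*} [NormedAddCommGroup E] [NormedSpace ℝ E] [FiniteDimensional ℝ E]
  [MeasurableSpace E] [BorelSpace E] {μ : Measure E} [μ.IsAddHaarMeasure]

theorem lintegral_ball_comp_sub_le (f : E → ℝ≥0∞) {R δ : ℝ} {t : E} (ht : ‖t‖ ≤ δ) :
    ∫⁻ x in Metric.ball 0 R, f (x - t) ∂μ ≤ ∫⁻ x in Metric.ball 0 (R + δ), f x ∂μ := by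
  rw [← lintegral_indicator Metric.isOpen_ball.measurableSet,
    ← lintegral_indicator Metric.isOpen_ball.measurableSet,
    ← lintegral_sub_right_eq_self (μ := μ) ((Metric.ball (0 : E) (R + δ)).indicator f) t]
  refine lintegral_mono fun x => ?_
  refine Set.indicator_le' (f := fun x => f (x - t))
    (g := fun x => (Metric.ball 0 (R + δ)).indicator f (x - t)) (fun a ha => ?_)
    (fun _ _ => zero_le) x
  rw [Set.indicator_of_mem]
  rw [mem_ball_zero_iff] at ha ⊢
  linarith [norm_sub_le a t]

theorem lintegral_enorm_normed (φ : ContDiffBump (0 : E)) : ∫⁻ t, ‖φ.normed μ t‖ₑ ∂μ = 1 := by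
  have h := φ.integral_normed (μ := μ)
  have h2 := ofReal_integral_norm_eq_lintegral_enorm (φ.integrable_normed (μ := μ))
  rw [← h2]
  simp only [Real.norm_of_nonneg (φ.nonneg_normed _), h, ENNReal.ofReal_one]

theorem AEMeasurable.enorm_mul_comp_sub {f : E → ℝ≥0∞} (hf : AEMeasurable f μ)
    {ρ : E → ℝ} (hρ : Continuous ρ) (s : Set E) :
    AEMeasurable (fun p : E × E => ‖ρ p.2‖ₑ * f (p.1 - p.2)) ((μ.restrict s).prod μ) := by
  refine AEMeasurable.mul (by fun_prop) ?_
  have h := hf.comp_quasiMeasurePreserving (quasiMeasurePreserving_sub μ μ)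
  exact h.mono_ac (Measure.AbsolutelyContinuous.prod Measure.restrict_le_self.absolutelyContinuous
    Measure.AbsolutelyContinuous.rfl)

/-- By Tonelli, the average over `t` of integrals over shifted balls, each contained in the ball
enlarged by `φ.rOut`; the kernel has mass one. -/
theorem lintegral_ball_average_le (φ : ContDiffBump (0 : E)) {f : E → ℝ≥0∞}
    (hf : AEMeasurable f μ) (R : ℝ) :
    ∫⁻ x in Metric.ball 0 R, ∫⁻ t, ‖φ.normed μ t‖ₑ * f (x - t) ∂μ ∂μ ≤
      ∫⁻ x in Metric.ball 0 (R + φ.rOut), f x ∂μ := by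
  rw [lintegral_lintegral_swap (hf.enorm_mul_comp_sub φ.continuous_normed _)]
  calc _ ≤ ∫⁻ t, ‖φ.normed μ t‖ₑ * ∫⁻ x in Metric.ball 0 (R + φ.rOut), f x ∂μ ∂μ := by
        refine lintegral_mono fun t => ?_
        rw [lintegral_const_mul' _ _ enorm_ne_top]
        by_cases ht : t ∈ Metric.ball (0 : E) φ.rOut
        · gcongr ‖φ.normed μ t‖ₑ * ?_
          exact lintegral_ball_comp_sub_le (μ := μ) f (mem_ball_zero_iff.1 ht).le
        · rw [← φ.support_normed_eq (μ := μ), Function.notMem_support] at ht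
          simp [ht]
    _ = _ := by
        rw [lintegral_mul_const _ (by have := φ.continuous_normed (μ := μ); fun_prop),
          lintegral_enorm_normed, one_mul]

theorem lintegral_ball_enorm_sub_le_of_contDiff {v : E → ℝ} (hv : ContDiff ℝ 1 v) (R : ℝ) (y : E) :
    ∫⁻ x in Metric.ball 0 R, ‖v (x - y) - v x‖ₑ ∂μ ≤
      ‖y‖ₑ * ∫⁻ x in Metric.ball 0 (R + ‖y‖), ‖fderiv ℝ v x‖ₑ ∂μ := by
  have hc : Continuous (fderiv ℝ v) := hv.continuous_fderiv one_ne_zero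
  calc _ ≤ ∫⁻ x in Metric.ball 0 R,
        (‖y‖ₑ * ∫⁻ s in Set.Icc (0 : ℝ) 1, ‖fderiv ℝ v (x - s • y)‖ₑ) ∂μ :=
        lintegral_mono fun x => enorm_sub_le_lintegral_fderiv hv x y
    _ = ‖y‖ₑ * ∫⁻ s in Set.Icc (0 : ℝ) 1, (∫⁻ x in Metric.ball 0 R,
          ‖fderiv ℝ v (x - s • y)‖ₑ ∂μ) := by
        rw [lintegral_const_mul' _ _ enorm_ne_top, lintegral_lintegral_swap]
        have : Continuous (fun p : E × ℝ => ‖fderiv ℝ v (p.1 - p.2 • y)‖ₑ) := by fun_prop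
        exact this.measurable.aemeasurable
    _ ≤ ‖y‖ₑ * ∫⁻ s in Set.Icc (0 : ℝ) 1, (∫⁻ x in Metric.ball 0 (R + ‖y‖),
          ‖fderiv ℝ v x‖ₑ ∂μ) := by
        gcongr ‖y‖ₑ * ?_
        refine setLIntegral_mono' measurableSet_Icc fun s hs => ?_
        refine lintegral_ball_comp_sub_le (fun x => ‖fderiv ℝ v x‖ₑ) ?_
        rw [norm_smul, Real.norm_of_nonneg hs.1]
        exact mul_le_of_le_one_left (norm_nonneg _) hs.2
    _ = _ := by simp

end Translation

/-! ### Mollification of weakly differentiable functions. -/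

open scoped Convolution

/-- Test the weak gradient against `z ↦ ρ (x - z)`: the sign from the chain rule cancels the one
from integration by parts. -/
theorem HasWeakGradient.fderiv_convolution_apply_single {N : ℕ}
    {u : EuclideanSpace ℝ (Fin N) → ℝ}
    {g : EuclideanSpace ℝ (Fin N) → EuclideanSpace ℝ (Fin N)} (h : HasWeakGradient u g)
    {ρ : EuclideanSpace ℝ (Fin N) → ℝ} (hρ : ContDiff ℝ ∞ ρ) (hc : HasCompactSupport ρ)
    (x : EuclideanSpace ℝ (Fin N)) (i : Fin N) :
    fderiv ℝ (ρ ⋆[ContinuousLinearMap.lsmul ℝ ℝ, volume] u) x (EuclideanSpace.single i 1) =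
      ∫ t, ρ t * g (x - t) i := by
  have h1 := hc.hasFDerivAt_convolution_left (ContinuousLinearMap.lsmul ℝ ℝ)
    (hρ.of_le (by simp)) h.locallyIntegrable x
  have hd : ∀ z, HasFDerivAt (fun z => ρ (x - z)) (-(fderiv ℝ ρ (x - z))) z := by
    intro z
    have := ((hρ.differentiable (by simp)) (x - z)).hasFDerivAt.comp z
      ((hasFDerivAt_id z).const_sub x)
    exact this.congr_fderiv (by ext; simp)
  have hcs : HasCompactSupport (fun z => ρ (x - z)) := hc.comp_homeomorph (Homeomorph.subLeft x)
  have h2 := h.integral_eq (fun z => ρ (x - z)) (by fun_prop) hcs i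
  simp only [(hd _).fderiv] at h2
  have hex := (hc.fderiv (𝕜 := ℝ)).convolutionExists_left
    ((ContinuousLinearMap.lsmul ℝ ℝ).precompL (EuclideanSpace ℝ (Fin N)))
    (hρ.continuous_fderiv (by simp)) h.locallyIntegrable x
  rw [h1.fderiv, convolution_def, ContinuousLinearMap.integral_apply hex]
  rw [← integral_sub_left_eq_self (fun t => ρ t * g (x - t) i) volume x,
    ← integral_sub_left_eq_self _ volume x]
  simp only [sub_sub_cancel, ContinuousLinearMap.precompL_apply]
  simp only [ContinuousLinearMap.lsmul_apply, smul_eq_mul]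
  simp only [neg_apply, mul_neg, integral_neg, neg_inj] at h2
  simp only [mul_comm (ρ _), ← h2, mul_comm (u _)]

/-- The derivative is the inner product with the vector `∫ ρ(t) g(x - t)`, checked on the standard
basis; the Riesz map is isometric, so no dimensional constant appears. -/
theorem HasWeakGradient.enorm_fderiv_convolution_le {N : ℕ}
    {u : EuclideanSpace ℝ (Fin N) → ℝ}
    {g : EuclideanSpace ℝ (Fin N) → EuclideanSpace ℝ (Fin N)} (h : HasWeakGradient u g)
    {ρ : EuclideanSpace ℝ (Fin N) → ℝ} (hρ : ContDiff ℝ ∞ ρ) (hc : HasCompactSupport ρ)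
    (x : EuclideanSpace ℝ (Fin N)) :
    ‖fderiv ℝ (ρ ⋆[ContinuousLinearMap.lsmul ℝ ℝ, volume] u) x‖ₑ ≤
      ∫⁻ t, ‖ρ t‖ₑ * ‖g (x - t)‖ₑ := by
  have hex : Integrable (fun t => ρ t • g (x - t)) :=
    hc.convolutionExists_left (ContinuousLinearMap.lsmul ℝ ℝ) hρ.continuous
      h.locallyIntegrable_grad x
  have key : fderiv ℝ (ρ ⋆[ContinuousLinearMap.lsmul ℝ ℝ, volume] u) x =
      innerSL ℝ (∫ t, ρ t • g (x - t)) := by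
    refine ContinuousLinearMap.coe_injective
      ((EuclideanSpace.basisFun (Fin N) ℝ).toBasis.ext fun i => ?_)
    have := (EuclideanSpace.proj (𝕜 := ℝ) i).integral_comp_comm hex
    simp only [PiLp.proj_apply, PiLp.smul_apply, smul_eq_mul] at this
    simp [h.fderiv_convolution_apply_single hρ hc, this, EuclideanSpace.inner_single_right]
  have h3 : ‖innerSL ℝ (∫ t, ρ t • g (x - t))‖ₑ = ‖∫ t, ρ t • g (x - t)‖ₑ := by
    rw [← ofReal_norm, ← ofReal_norm, innerSL_apply_norm]
  rw [key, h3]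
  refine (enorm_integral_le_lintegral_enorm _).trans_eq ?_
  simp only [enorm_smul]

/-- Bump functions at the origin with outer radius `1 / (n + 1)` and half that inner radius. -/
noncomputable def shrinkingBump (E : Type*) [NormedAddCommGroup E] (n : ℕ) :
    ContDiffBump (0 : E) where
  rIn := 1 / (2 * ((n : ℝ) + 1))
  rOut := 1 / ((n : ℝ) + 1)
  rIn_pos := by positivity
  rIn_lt_rOut := by
    apply one_div_lt_one_div_of_lt <;> [positivity; skip]
    have : (0 : ℝ) ≤ n := n.cast_nonneg
    linarith

theorem shrinkingBump_rOut_le_one (E : Type*) [NormedAddCommGroup E] (n : ℕ) :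
    (shrinkingBump E n).rOut ≤ 1 := by
  show 1 / ((n : ℝ) + 1) ≤ 1
  rw [div_le_one (by positivity)]
  have : (0 : ℝ) ≤ n := n.cast_nonneg
  linarith

/-- Translation estimate for functions with a weak gradient. -/
theorem HasWeakGradient.lintegral_ball_enorm_sub_le {N : ℕ}
    {u : EuclideanSpace ℝ (Fin N) → ℝ}
    {g : EuclideanSpace ℝ (Fin N) → EuclideanSpace ℝ (Fin N)} (h : HasWeakGradient u g)
    (R : ℝ) (y : EuclideanSpace ℝ (Fin N)) :
    ∫⁻ x in Metric.ball 0 R, ‖u (x - y) - u x‖ₑ ≤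
      ‖y‖ₑ * ∫⁻ x in Metric.ball 0 (R + ‖y‖ + 1), ‖g x‖ₑ := by
  let φ := shrinkingBump (EuclideanSpace ℝ (Fin N))
  have hle := shrinkingBump_rOut_le_one (EuclideanSpace ℝ (Fin N))
  let v : ℕ → EuclideanSpace ℝ (Fin N) → ℝ := fun n =>
    (φ n).normed volume ⋆[ContinuousLinearMap.lsmul ℝ ℝ, volume] u
  have hv : ∀ᵐ x, Tendsto (fun n => v n x) atTop (𝓝 (u x)) := by
    -- The constant ratio `2` of outer to inner radius makes Lebesgue differentiation applicable.
    refine ContDiffBump.ae_convolution_tendsto_right_of_locallyIntegrable (K := 2)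
      tendsto_one_div_add_atTop_nhds_zero_nat (Eventually.of_forall fun n => le_of_eq ?_)
      h.locallyIntegrable
    show 1 / ((n : ℝ) + 1) = 2 * (1 / (2 * ((n : ℝ) + 1)))
    field_simp
  have hvc : ∀ n, ContDiff ℝ 1 (v n) := fun n =>
    (φ n).hasCompactSupport_normed.contDiff_convolution_left _ (φ n).contDiff_normed
      h.locallyIntegrable
  have hv' : ∀ᵐ x, Tendsto (fun n => v n (x - y)) atTop (𝓝 (u (x - y))) :=
    (measurePreserving_sub_right volume y).quasiMeasurePreserving.ae hv
  have hvlim : ∀ᵐ x, Tendsto (fun n => ‖v n (x - y) - v n x‖ₑ) atTop (𝓝 ‖u (x - y) - u x‖ₑ) := by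
    filter_upwards [hv, hv'] with x h1 h2 using (h2.sub h1).enorm
  -- Fatou transfers the smooth estimate to `u`; the extra `1` in the final radius absorbs the width
  -- of the mollifier.
  calc _ = ∫⁻ x in Metric.ball 0 R, liminf (fun n => ‖v n (x - y) - v n x‖ₑ) atTop := by
        refine lintegral_congr_ae ?_
        filter_upwards [ae_restrict_of_ae hvlim] with x hx using hx.liminf_eq.symm
    _ ≤ liminf (fun n => ∫⁻ x in Metric.ball 0 R, ‖v n (x - y) - v n x‖ₑ) atTop := by
        refine lintegral_liminf_le fun n => ?_
        have := (hvc n).continuous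
        fun_prop
    _ ≤ _ := by
        refine liminf_le_of_le (by isBoundedDefault) fun b hb => ?_
        obtain ⟨n, hn⟩ := hb.exists
        refine hn.trans ((lintegral_ball_enorm_sub_le_of_contDiff (hvc n) R y).trans ?_)
        gcongr ‖y‖ₑ * ?_
        calc _ ≤ _ := lintegral_mono fun x => h.enorm_fderiv_convolution_le
              (φ n).contDiff_normed (φ n).hasCompactSupport_normed x
          _ ≤ _ := lintegral_ball_average_le (φ n)
              h.locallyIntegrable_grad.aestronglyMeasurable.enorm _
          _ ≤ _ := lintegral_mono_set (Metric.ball_subset_ball (by linarith [hle n]))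

/-- The kernel has mass one, so the error is an average of `u (x - t) - u x` over `‖t‖ < φ.rOut`,
controlled by the translation estimate. The radius is `R + ‖t‖ + 1 ≤ R + 2`. -/
theorem HasWeakGradient.lintegral_ball_enorm_convolution_sub_le {N : ℕ}
    {u : EuclideanSpace ℝ (Fin N) → ℝ}
    {g : EuclideanSpace ℝ (Fin N) → EuclideanSpace ℝ (Fin N)} (h : HasWeakGradient u g)
    (φ : ContDiffBump (0 : EuclideanSpace ℝ (Fin N))) (hφ : φ.rOut ≤ 1) (R : ℝ) :
    ∫⁻ x in Metric.ball 0 R,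
        ‖(φ.normed volume ⋆[ContinuousLinearMap.lsmul ℝ ℝ, volume] u) x - u x‖ₑ ≤
      ENNReal.ofReal φ.rOut * ∫⁻ x in Metric.ball 0 (R + 2), ‖g x‖ₑ := by
  have hpt : ∀ x, ‖(φ.normed volume ⋆[ContinuousLinearMap.lsmul ℝ ℝ, volume] u) x - u x‖ₑ ≤
      ∫⁻ t, ‖φ.normed volume t‖ₑ * ‖u (x - t) - u x‖ₑ := by
    intro x
    have hex : Integrable (fun t => φ.normed volume t • u (x - t)) :=
      φ.hasCompactSupport_normed.convolutionExists_left (ContinuousLinearMap.lsmul ℝ ℝ)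
        φ.continuous_normed h.locallyIntegrable x
    have : (φ.normed volume ⋆[ContinuousLinearMap.lsmul ℝ ℝ, volume] u) x - u x =
        ∫ t, φ.normed volume t * (u (x - t) - u x) := by
      simp only [smul_eq_mul] at hex
      simp only [mul_sub]
      rw [integral_sub hex (φ.integrable_normed.mul_const _), integral_mul_const,
        φ.integral_normed, one_mul, convolution_def]
      simp
    rw [this]
    refine (enorm_integral_le_lintegral_enorm _).trans_eq ?_
    simp only [enorm_mul]
  have hm := h.locallyIntegrable.aestronglyMeasurable
  calc _ ≤ _ := lintegral_mono hpt
    _ = ∫⁻ t, ‖φ.normed volume t‖ₑ *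
          ∫⁻ x in Metric.ball 0 R, ‖u (x - t) - u x‖ₑ := by
        rw [lintegral_lintegral_swap]
        · simp only [lintegral_const_mul' _ _ enorm_ne_top]
        · refine AEMeasurable.mul (f := fun p : _ × EuclideanSpace ℝ (Fin N) =>
            ‖φ.normed volume p.2‖ₑ) ?_ ?_
          · have := φ.continuous_normed (μ := volume); fun_prop
          · refine AEStronglyMeasurable.enorm (AEStronglyMeasurable.sub ?_ ?_)
            · exact (hm.comp_quasiMeasurePreserving
                (quasiMeasurePreserving_sub volume volume)).mono_ac
                (Measure.AbsolutelyContinuous.prod Measure.restrict_le_self.absolutelyContinuous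
                  Measure.AbsolutelyContinuous.rfl)
            · exact hm.restrict.comp_fst
    _ ≤ ∫⁻ t, ‖φ.normed volume t‖ₑ * (ENNReal.ofReal φ.rOut *
          ∫⁻ x in Metric.ball 0 (R + 2), ‖g x‖ₑ) := by
        refine lintegral_mono fun t => ?_
        by_cases ht : t ∈ Metric.ball (0 : EuclideanSpace ℝ (Fin N)) φ.rOut
        · rw [mem_ball_zero_iff] at ht
          gcongr ‖φ.normed volume t‖ₑ * ?_
          refine (h.lintegral_ball_enorm_sub_le R t).trans ?_
          rw [← ofReal_norm]
          exact mul_le_mul' (ENNReal.ofReal_le_ofReal ht.le)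
            (lintegral_mono_set (Metric.ball_subset_ball (by linarith)))
        · rw [← φ.support_normed_eq (μ := volume), Function.notMem_support] at ht
          simp [ht]
    _ = _ := by
        rw [lintegral_mul_const _ (by have := φ.continuous_normed (μ := volume); fun_prop),
          lintegral_enorm_normed, one_mul]

/-! ### Extraction of subsequences and local Rellich compactness. -/

/-- A sequence that is Cauchy in `L¹` of every ball has a subsequence converging a.e. -/
theorem exists_subseq_ae_tendsto_of_cauchy_lintegral_ball {E : Type*}
    [NormedAddCommGroup E] [MeasurableSpace E] {μ : Measure E} {u : ℕ → E → ℝ}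
    (hm : ∀ n, AEStronglyMeasurable (u n) μ)
    (hu : ∀ R : ℝ, Tendsto (fun p : ℕ × ℕ => ∫⁻ x in Metric.ball 0 R, ‖u p.1 x - u p.2 x‖ₑ ∂μ)
      atTop (𝓝 0)) :
    ∃ s : ℕ → ℕ, StrictMono s ∧ ∃ w : E → ℝ, Measurable w ∧
      ∀ᵐ x ∂μ, Tendsto (fun n => u (s n) x) atTop (𝓝 (w x)) := by
  -- Coupling the radius `j` with the accuracy `2^(-j)` lets one subsequence serve all balls.
  have h1 : ∀ j : ℕ, ∃ K, ∀ k ≥ K, ∀ n ≥ k, ∀ m ≥ k,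
      ∫⁻ x in Metric.ball 0 (j : ℝ), ‖u n x - u m x‖ₑ ∂μ < (1 / 2 : ℝ≥0∞) ^ j := by
    intro j
    have hlt := (hu j).eventually_lt_const (u := (1 / 2 : ℝ≥0∞) ^ j)
      (ENNReal.pow_pos (by simp) j)
    obtain ⟨⟨a, b⟩, hab⟩ := eventually_atTop.1 hlt
    refine ⟨max a b, fun k hk n hn m hm => hab (n, m) ⟨?_, ?_⟩⟩
    · exact (le_max_left a b).trans (hk.trans hn)
    · exact (le_max_right a b).trans (hk.trans hm)
  obtain ⟨s, hs, hP⟩ := extraction_forall_of_eventually' h1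
  refine ⟨s, hs, measurable_limit_of_tendsto_metrizable_ae (fun n => (hm _).aemeasurable) ?_⟩
  have h2 : ∀ i : ℕ, ∀ᵐ x ∂(μ.restrict (Metric.ball 0 (i : ℝ))),
      ∃ l, Tendsto (fun n => u (s n) x) atTop (𝓝 l) := by
    intro i
    -- Dropping the first `i` terms leaves estimates on balls of radius at least `i`, with summable
    -- bounds.
    have h3 := Lp.ae_tendsto_of_cauchy_eLpNorm (μ := μ.restrict (Metric.ball 0 (i : ℝ)))
      (f := fun n => u (s (n + i))) (p := 1) (fun n => (hm _).restrict) le_rfl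
      (B := fun n => (1 / 2 : ℝ≥0∞) ^ (n + i)) ?_ ?_
    · filter_upwards [h3] with x ⟨l, hl⟩
      exact ⟨l, (tendsto_add_atTop_iff_nat i).1 hl⟩
    · rw [tsum_congr fun n => pow_add _ n i, ENNReal.tsum_mul_right, ENNReal.tsum_geometric]
      refine ENNReal.mul_ne_top (by simp) (by simp)
    · intro j n m hn hm'
      rw [eLpNorm_one_eq_lintegral_enorm]
      refine lt_of_le_of_lt (lintegral_mono_set (Metric.ball_subset_ball ?_))
        (hP (j + i) _ (hs.monotone (by omega : j + i ≤ n + i)) _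
          (hs.monotone (by omega : j + i ≤ m + i)))
      push_cast
      linarith [(Nat.cast_nonneg j : (0 : ℝ) ≤ j)]
  have h4 : (⋃ i : ℕ, Metric.ball (0 : E) i) = Set.univ := Metric.iUnion_ball_nat 0
  have := (ae_restrict_iUnion_iff (μ := μ) (fun i : ℕ => Metric.ball (0 : E) i) _).2 h2
  rwa [h4, Measure.restrict_univ] at this

section Convolution

variable {E : Type*} [NormedAddCommGroup E] [NormedSpace ℝ E] [FiniteDimensional ℝ E]
  [MeasurableSpace E] [BorelSpace E] {μ : Measure E} [μ.IsAddHaarMeasure]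

theorem enorm_convolution_le_lintegral_ball {ρ u : E → ℝ} {M : ℝ≥0} (hM : ∀ x, ‖ρ x‖ₑ ≤ M)
    (hs : Function.support ρ ⊆ Metric.closedBall 0 1) {R : ℝ} {x : E} (hx : ‖x‖ < R) :
    ‖(ρ ⋆[ContinuousLinearMap.lsmul ℝ ℝ, μ] u) x‖ₑ ≤
      M * ∫⁻ z in Metric.ball 0 (R + 1), ‖u z‖ₑ ∂μ := by
  rw [convolution_lsmul_swap, ← lintegral_const_mul' _ _ ENNReal.coe_ne_top,
    ← lintegral_indicator Metric.isOpen_ball.measurableSet]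
  refine (enorm_integral_le_lintegral_enorm _).trans (lintegral_mono fun z => ?_)
  by_cases hz : ρ (x - z) = 0
  · simp [hz]
  · have h1 : ‖x - z‖ ≤ 1 := by simpa using hs hz
    rw [Set.indicator_of_mem, enorm_smul]
    · exact mul_le_mul' (hM _) le_rfl
    · rw [mem_ball_zero_iff]
      linarith [norm_le_norm_add_norm_sub x z]

/-- Gives equicontinuity: the Lipschitz constant on a ball depends on `u` only through its `L¹` norm
on the ball enlarged by the support radius of `ρ`. -/
theorem edist_convolution_le_lintegral_ball {ρ u : E → ℝ} {L : ℝ≥0} (hL : LipschitzWith L ρ)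
    (hc : HasCompactSupport ρ) (hu : LocallyIntegrable u μ)
    (hs : Function.support ρ ⊆ Metric.closedBall 0 1) {R : ℝ} {x y : E}
    (hx : ‖x‖ < R) (hy : ‖y‖ < R) :
    edist ((ρ ⋆[ContinuousLinearMap.lsmul ℝ ℝ, μ] u) x)
        ((ρ ⋆[ContinuousLinearMap.lsmul ℝ ℝ, μ] u) y) ≤
      L * edist x y * ∫⁻ z in Metric.ball 0 (R + 1), ‖u z‖ₑ ∂μ := by
  have hex : ∀ x, Integrable (fun z => ρ (x - z) • u z) μ := fun x =>
    (hc.convolutionExists_left (ContinuousLinearMap.lsmul ℝ ℝ) hL.continuous hu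
      x).integrable_swap
  rw [edist_eq_enorm_sub, convolution_lsmul_swap, convolution_lsmul_swap,
    ← integral_sub (hex x) (hex y),
    ← lintegral_const_mul' _ _ (ENNReal.mul_ne_top ENNReal.coe_ne_top (edist_ne_top _ _)),
    ← lintegral_indicator Metric.isOpen_ball.measurableSet]
  refine (enorm_integral_le_lintegral_enorm _).trans (lintegral_mono fun z => ?_)
  rw [← sub_smul]
  have hball : ∀ w : E, ‖w‖ < R → ρ (w - z) ≠ 0 → z ∈ Metric.ball (0 : E) (R + 1) := by
    intro w hw hz
    have h1 : ‖w - z‖ ≤ 1 := by simpa using hs hz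
    rw [mem_ball_zero_iff]
    linarith [norm_le_norm_add_norm_sub w z]
  by_cases hz : z ∈ Metric.ball (0 : E) (R + 1)
  · rw [Set.indicator_of_mem hz, enorm_smul, ← edist_eq_enorm_sub]
    gcongr
    simpa using hL (x - z) (y - z)
  · have h1 : ρ (x - z) = 0 := by_contra fun h => hz (hball x hx h)
    have h2 : ρ (y - z) = 0 := by_contra fun h => hz (hball y hy h)
    simp [h1, h2]

/-- The mollifications of a locally `L¹`-bounded sequence converge pointwise along a common
subsequence. -/
theorem exists_subseq_cauchySeq_convolution {u : ℕ → E → ℝ}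
    (hloc : ∀ n, LocallyIntegrable (u n) μ)
    (hu : ∀ R : ℝ, ∃ C : ℝ≥0, ∀ n, ∫⁻ x in Metric.ball 0 R, ‖u n x‖ₑ ∂μ ≤ C)
    {ρ : ℕ → E → ℝ} (hρ : ∀ k, ContDiff ℝ 1 (ρ k)) (hc : ∀ k, HasCompactSupport (ρ k))
    (hs : ∀ k, Function.support (ρ k) ⊆ Metric.closedBall 0 1) :
    ∃ s : ℕ → ℕ, StrictMono s ∧ ∀ k x,
      CauchySeq fun n => (ρ k ⋆[ContinuousLinearMap.lsmul ℝ ℝ, μ] u (s n)) x := by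
  choose C hC using hu
  have hbd : ∀ k, ∃ M : ℝ≥0, ∀ x, ‖ρ k x‖ₑ ≤ M := by
    intro k
    obtain ⟨M, hM⟩ := (hc k).exists_bound_of_continuous (hρ k).continuous
    exact ⟨M.toNNReal, fun x => by
      rw [← ofReal_norm]
      exact ENNReal.ofReal_le_ofReal (hM x)⟩
  choose M hM using hbd
  have hLip : ∀ k, ∃ L : ℝ≥0, LipschitzWith L (ρ k) := fun k =>
    (hρ k).lipschitzWith_of_hasCompactSupport (hc k) one_ne_zero
  choose L hL using hLip
  let d : ℕ → E := TopologicalSpace.denseSeq E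
  let c : ℕ → ℕ → E → ℝ := fun k n => ρ k ⋆[ContinuousLinearMap.lsmul ℝ ℝ, μ] u n
  -- One `1` makes the norm strictly less than the radius; the other is the support radius.
  let b : ℕ × ℕ → ℝ := fun i => M i.1 * C (‖d i.2‖ + 1 + 1)
  have hmem : ∀ n, (fun i : ℕ × ℕ => c i.1 n (d i.2)) ∈
      Set.univ.pi (fun i => Metric.closedBall (0 : ℝ) (b i)) := by
    intro n i _
    rw [mem_closedBall_zero_iff]
    have h1 := (enorm_convolution_le_lintegral_ball (μ := μ) (u := u n) (hM i.1) (hs i.1)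
      (lt_add_one ‖d i.2‖)).trans (mul_le_mul' le_rfl (hC _ n))
    rw [← ENNReal.coe_mul, enorm_le_coe] at h1
    exact_mod_cast h1
  -- Compactness of a countable product of intervals replaces the diagonal argument over all scales
  -- and dense points.
  obtain ⟨a, -, s, hsm, hlim⟩ :=
    (isCompact_univ_pi fun i => isCompact_closedBall (0 : ℝ) (b i)).tendsto_subseq hmem
  rw [tendsto_pi_nhds] at hlim
  refine ⟨s, hsm, fun k x => ?_⟩
  rw [EMetric.cauchySeq_iff]
  intro ε hε
  let A : ℝ≥0 := L k * C (‖x‖ + 1 + 1)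
  have hpos : 0 < ε / 3 := ENNReal.div_pos hε.ne' (by simp)
  -- Equicontinuity carries the Cauchy property from the dense sequence to `x`.
  have hd : ∀ᶠ y in 𝓝 x, ‖y‖ < ‖x‖ + 1 ∧ A * edist x y < ε / 3 := by
    refine (continuous_norm.continuousAt.eventually_lt continuousAt_const (lt_add_one ‖x‖)).and ?_
    have : Tendsto (fun y => (A : ℝ≥0∞) * edist x y) (𝓝 x) (𝓝 (A * edist x x)) :=
      ENNReal.Tendsto.const_mul ((continuous_const.edist continuous_id).tendsto x)
        (Or.inr ENNReal.coe_ne_top)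
    refine this.eventually_lt_const ?_
    simpa using hpos
  obtain ⟨_, ⟨j, rfl⟩, hy1, hy2⟩ :=
    (TopologicalSpace.denseRange_denseSeq E).inter_nhds_nonempty hd
  have hclose : ∀ n, edist (c k (s n) x) (c k (s n) (d j)) < ε / 3 := by
    intro n
    refine lt_of_le_of_lt ?_ hy2
    refine (edist_convolution_le_lintegral_ball (hL k) (hc k) (hloc _) (hs k)
      (lt_add_one ‖x‖) hy1).trans ?_
    rw [ENNReal.coe_mul, mul_right_comm]
    gcongr
    exact hC _ _
  obtain ⟨n₀, hn₀⟩ := EMetric.cauchySeq_iff.1 (hlim (k, j)).cauchySeq _ hpos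
  refine ⟨n₀, fun m hm n hn => ?_⟩
  calc edist (c k (s m) x) (c k (s n) x)
      ≤ edist (c k (s m) x) (c k (s m) (d j)) + edist (c k (s m) (d j)) (c k (s n) (d j)) +
        edist (c k (s n) (d j)) (c k (s n) x) := edist_triangle4 _ _ _ _
    _ < ε / 3 + ε / 3 + ε / 3 := by
        refine ENNReal.add_lt_add (ENNReal.add_lt_add (hclose m) (hn₀ m hm n hn)) ?_
        rw [edist_comm]
        exact hclose n
    _ = ε := ENNReal.add_thirds ε

end Convolution

/-- Local Rellich compactness: a sequence of weakly differentiable functions which is bounded,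
together with the gradients, in `L¹` of every ball, has a subsequence converging a.e. -/
theorem exists_subseq_ae_tendsto_of_hasWeakGradient {N : ℕ}
    {u : ℕ → EuclideanSpace ℝ (Fin N) → ℝ}
    {g : ℕ → EuclideanSpace ℝ (Fin N) → EuclideanSpace ℝ (Fin N)}
    (h : ∀ n, HasWeakGradient (u n) (g n))
    (hu : ∀ R : ℝ, ∃ C : ℝ≥0, ∀ n, ∫⁻ x in Metric.ball 0 R, ‖u n x‖ₑ ≤ C)
    (hg : ∀ R : ℝ, ∃ C : ℝ≥0, ∀ n, ∫⁻ x in Metric.ball 0 R, ‖g n x‖ₑ ≤ C) :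
    ∃ s : ℕ → ℕ, StrictMono s ∧ ∃ w : EuclideanSpace ℝ (Fin N) → ℝ, Measurable w ∧
      ∀ᵐ x, Tendsto (fun n => u (s n) x) atTop (𝓝 (w x)) := by
  let φ := shrinkingBump (EuclideanSpace ℝ (Fin N))
  have hle := shrinkingBump_rOut_le_one (EuclideanSpace ℝ (Fin N))
  have hsupp : ∀ k, Function.support ((φ k).normed volume) ⊆ Metric.closedBall 0 1 := fun k => by
    rw [ContDiffBump.support_normed_eq]
    exact Metric.ball_subset_closedBall.trans (Metric.closedBall_subset_closedBall (hle k))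
  obtain ⟨s, hs, hcau⟩ := exists_subseq_cauchySeq_convolution (fun n => (h n).locallyIntegrable) hu
    (ρ := fun k => (φ k).normed volume) (fun k => (φ k).contDiff_normed)
    (fun k => (φ k).hasCompactSupport_normed) hsupp
  let c : ℕ → ℕ → EuclideanSpace ℝ (Fin N) → ℝ := fun k n =>
    (φ k).normed volume ⋆[ContinuousLinearMap.lsmul ℝ ℝ, volume] u (s n)
  have hcc : ∀ k n, Continuous (c k n) := fun k n =>
    (φ k).hasCompactSupport_normed.continuous_convolution_left _ (φ k).continuous_normed
      (h _).locallyIntegrable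
  have hconv : ∀ (R : ℝ) (k : ℕ), Tendsto (fun p : ℕ × ℕ =>
      ∫⁻ x in Metric.ball 0 R, ‖c k p.1 x - c k p.2 x‖ₑ) atTop (𝓝 0) := by
    intro R k
    obtain ⟨C, hC⟩ := hu (R + 1)
    obtain ⟨M, hM⟩ := (φ k).hasCompactSupport_normed.exists_bound_of_continuous
      ((φ k).continuous_normed (μ := volume))
    have hM' : ∀ x, ‖(φ k).normed volume x‖ₑ ≤ M.toNNReal := fun x => by
      rw [← ofReal_norm]; exact ENNReal.ofReal_le_ofReal (hM x)
    have hb : ∀ n, ∀ x ∈ Metric.ball (0 : EuclideanSpace ℝ (Fin N)) R,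
        ‖c k n x‖ₑ ≤ M.toNNReal * C := fun n x hx =>
      (enorm_convolution_le_lintegral_ball hM' (hsupp k) (mem_ball_zero_iff.1 hx)).trans
        (mul_le_mul' le_rfl (hC _))
    rw [← lintegral_zero (μ := volume.restrict (Metric.ball (0 : EuclideanSpace ℝ (Fin N)) R))]
    refine tendsto_lintegral_filter_of_dominated_convergence
      (fun _ => M.toNNReal * C + M.toNNReal * C) (Eventually.of_forall fun p => ?_)
      (Eventually.of_forall fun p => ?_) ?_ (Eventually.of_forall fun x => ?_)
    · have h1 := hcc k p.1
      have h2 := hcc k p.2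
      fun_prop
    · filter_upwards [ae_restrict_mem Metric.isOpen_ball.measurableSet] with x hx
      exact (enorm_sub_le).trans (add_le_add (hb _ x hx) (hb _ x hx))
    · rw [setLIntegral_const]
      exact ENNReal.mul_ne_top (by finiteness) measure_ball_lt_top.ne
    · have := cauchySeq_iff_tendsto_dist_atTop_0.1 (hcau k x)
      have h2 := ENNReal.tendsto_ofReal this
      simpa only [← edist_dist, edist_eq_enorm_sub, ENNReal.ofReal_zero] using h2
  suffices hL1 : ∀ R : ℝ, Tendsto (fun p : ℕ × ℕ =>
      ∫⁻ x in Metric.ball 0 R, ‖u (s p.1) x - u (s p.2) x‖ₑ) atTop (𝓝 0) by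
    obtain ⟨t, ht, w, hw, hlim⟩ := exists_subseq_ae_tendsto_of_cauchy_lintegral_ball
      (μ := volume) (u := fun n => u (s n))
      (fun n => (h _).locallyIntegrable.aestronglyMeasurable) hL1
    exact ⟨s ∘ t, hs.comp ht, w, hw, hlim⟩
  intro R
  obtain ⟨C, hC⟩ := hg (R + 2)
  rw [ENNReal.tendsto_nhds_zero]
  intro ε hε
  have hpos : 0 < ε / 3 := ENNReal.div_pos hε.ne' (by simp)
  have hsmall : Tendsto (fun k : ℕ => ENNReal.ofReal (φ k).rOut * C) atTop (𝓝 0) := by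
    have h1 := ENNReal.Tendsto.mul_const (b := (C : ℝ≥0∞)) (ENNReal.tendsto_ofReal
      (tendsto_one_div_add_atTop_nhds_zero_nat (𝕜 := ℝ))) (Or.inr ENNReal.coe_ne_top)
    rwa [ENNReal.ofReal_zero, zero_mul] at h1
  obtain ⟨k, hk⟩ := (ENNReal.tendsto_nhds_zero.1 hsmall _ hpos).exists
  -- The scale `k` is fixed before the indices: the mollification error is uniform in `n`.
  have hmol : ∀ n, ∫⁻ x in Metric.ball 0 R, ‖c k n x - u (s n) x‖ₑ ≤ ε / 3 := fun n =>
    ((h _).lintegral_ball_enorm_convolution_sub_le (φ k) (hle k) R).trans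
      ((mul_le_mul' le_rfl (hC _)).trans hk)
  filter_upwards [ENNReal.tendsto_nhds_zero.1 (hconv R k) _ hpos] with p hp
  have hme : ∀ n, AEMeasurable (fun x => ‖c k n x - u (s n) x‖ₑ)
      (volume.restrict (Metric.ball 0 R)) := fun n =>
    ((hcc k n).aestronglyMeasurable.sub
      (h _).locallyIntegrable.aestronglyMeasurable.restrict).enorm
  calc ∫⁻ x in Metric.ball 0 R, ‖u (s p.1) x - u (s p.2) x‖ₑ
      ≤ ∫⁻ x in Metric.ball 0 R, (‖c k p.1 x - u (s p.1) x‖ₑ + ‖c k p.1 x - c k p.2 x‖ₑ +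
          ‖c k p.2 x - u (s p.2) x‖ₑ) := by
        refine lintegral_mono fun x => ?_
        simp only [← edist_eq_enorm_sub]
        rw [edist_comm (c k p.1 x) (u (s p.1) x)]
        exact edist_triangle4 _ _ _ _
    _ = _ := by
        rw [lintegral_add_right' _ (hme _), lintegral_add_left' (hme _)]
    _ ≤ ε / 3 + ε / 3 + ε / 3 := add_le_add (add_le_add (hmol _) hp) (hmol _)
    _ = ε := ENNReal.add_thirds ε

/-! ### Boundedness and a.e. convergence against a dual function. -/

/-- Young's inequality for `δ a` and `δ⁻¹ b` with `δ = ε^(1/s)`; the factors `1/s` and `1/t` are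
discarded. -/
theorem ENNReal.exists_mul_le_mul_rpow_add {s t : ℝ} (hst : s.HolderConjugate t) {ε : ℝ≥0∞}
    (hε : ε ≠ 0) (hε' : ε ≠ ⊤) :
    ∃ D : ℝ≥0∞, D ≠ ⊤ ∧ ∀ a b : ℝ≥0∞, a * b ≤ ε * a ^ s + D * b ^ t := by
  set δ := ε ^ s⁻¹
  have hδ : δ ≠ 0 := (ENNReal.rpow_pos (pos_iff_ne_zero.2 hε) hε').ne'
  have hδ' : δ ≠ ⊤ := ENNReal.rpow_ne_top_of_nonneg hst.inv_pos.le hε'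
  refine ⟨δ⁻¹ ^ t, ENNReal.rpow_ne_top_of_nonneg hst.symm.nonneg (ENNReal.inv_ne_top.2 hδ),
    fun a b => ?_⟩
  have h1 : a * b = (δ * a) * (δ⁻¹ * b) := by
    rw [mul_mul_mul_comm, ENNReal.mul_inv_cancel hδ hδ', one_mul]
  have h2 : δ ^ s = ε := ENNReal.rpow_inv_rpow hst.ne_zero ε
  rw [h1]
  refine (ENNReal.young_inequality _ _ hst).trans ?_
  rw [ENNReal.mul_rpow_of_nonneg _ _ hst.nonneg, ENNReal.mul_rpow_of_nonneg _ _ hst.symm.nonneg, h2]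
  have hdiv : ∀ {c : ℝ≥0∞} {p : ℝ}, 1 ≤ p → c / ENNReal.ofReal p ≤ c := fun {c p} hp =>
    ENNReal.div_le_of_le_mul (le_mul_of_one_le_right zero_le (ENNReal.one_le_ofReal.2 hp))
  exact add_le_add (hdiv hst.lt.le) (hdiv hst.symm.lt.le)

/-- If `aₙ → 0` a.e. and `aₙ` is bounded in `L^s`, then `∫ aₙ b → 0` for every `b` in the dual
space `L^t`. -/
theorem tendsto_lintegral_mul_zero_of_bounded {α : Type*} {m : MeasurableSpace α} {μ : Measure α}
    {s t : ℝ} (hst : s.HolderConjugate t) {a : ℕ → α → ℝ≥0∞} {b : α → ℝ≥0∞}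
    (ha : ∀ n, AEMeasurable (a n) μ) (hb : AEMeasurable b μ) {C : ℝ≥0∞} (hC : C ≠ ⊤)
    (haC : ∀ n, ∫⁻ x, a n x ^ s ∂μ ≤ C) (hbt : ∫⁻ x, b x ^ t ∂μ ≠ ⊤)
    (hlim : ∀ᵐ x ∂μ, Tendsto (fun n => a n x) atTop (𝓝 0)) :
    Tendsto (fun n => ∫⁻ x, a n x * b x ∂μ) atTop (𝓝 0) := by
  rw [ENNReal.tendsto_nhds_zero]
  intro η hη
  obtain ⟨ε, hε, hεη⟩ : ∃ ε : ℝ≥0, 0 < ε ∧ ε * C < η := by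
    obtain ⟨ε, h1, h2⟩ := ENNReal.exists_nnreal_pos_mul_lt hC hη.ne'
    exact ⟨ε, h1, h2⟩
  obtain ⟨D, hD, hyoung⟩ := ENNReal.exists_mul_le_mul_rpow_add hst
    (ENNReal.coe_ne_zero.2 hε.ne') ENNReal.coe_ne_top
  have hb_fin : ∀ᵐ x ∂μ, b x ≠ ⊤ := by
    filter_upwards [ae_lt_top' (hb.pow_const t) hbt] with x hx
    intro h
    simp [h, hst.symm.pos] at hx
  -- Subtraction truncates at zero, so Young's inequality bounds the integrand by the fixed
  -- integrable function `D b^t`; the products `a n * b` themselves need have no common majorant.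
  have hdct : Tendsto (fun n => ∫⁻ x, (a n x * b x - ε * a n x ^ s) ∂μ) atTop (𝓝 0) := by
    rw [← lintegral_zero (μ := μ)]
    refine tendsto_lintegral_filter_of_dominated_convergence' (fun x => D * b x ^ t)
      (Eventually.of_forall fun n => ?_) (Eventually.of_forall fun n => ae_of_all _ fun x => ?_)
      ?_ ?_
    · exact ((ha n).mul hb).sub (((ha n).pow_const s).const_mul _)
    · exact tsub_le_iff_left.2 (hyoung _ _)
    · rw [lintegral_const_mul' _ _ hD]
      exact ENNReal.mul_ne_top hD hbt
    · filter_upwards [hlim, hb_fin] with x hx hbx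
      have h1 := ENNReal.Tendsto.mul_const hx (Or.inr hbx)
      rw [zero_mul] at h1
      exact tendsto_of_tendsto_of_tendsto_of_le_of_le tendsto_const_nhds h1
        (fun n => zero_le) (fun n => tsub_le_self)
  filter_upwards [hdct.eventually_le_const (tsub_pos_of_lt hεη)] with n hn
  calc ∫⁻ x, a n x * b x ∂μ
      ≤ ∫⁻ x, ((a n x * b x - ε * a n x ^ s) + ε * a n x ^ s) ∂μ :=
        lintegral_mono fun x => le_tsub_add
    _ = ∫⁻ x, (a n x * b x - ε * a n x ^ s) ∂μ + ε * ∫⁻ x, a n x ^ s ∂μ := by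
        rw [lintegral_add_right' _ (((ha n).pow_const s).const_mul _),
          lintegral_const_mul' _ _ ENNReal.coe_ne_top]
    _ ≤ (η - ε * C) + ε * C := by
        gcongr
        exact haC n
    _ = η := tsub_add_cancel_of_le hεη.le

theorem ENNReal.le_one_add_rpow {q : ℝ} (hq : 1 ≤ q) (a : ℝ≥0∞) : a ≤ 1 + a ^ q := by
  rcases le_total a 1 with h | h
  · exact h.trans le_self_add
  · exact (ENNReal.le_rpow_self_of_one_le h hq).trans le_add_self

theorem ENNReal.add_rpow_le_two_rpow_mul {q : ℝ} (hq : 0 ≤ q) (a b : ℝ≥0∞) :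
    (a + b) ^ q ≤ 2 ^ q * (a ^ q + b ^ q) := by
  have h1 : a + b ≤ 2 * max a b := by
    rw [two_mul]
    exact add_le_add (le_max_left _ _) (le_max_right _ _)
  refine (ENNReal.rpow_le_rpow h1 hq).trans ?_
  rw [ENNReal.mul_rpow_of_nonneg _ _ hq]
  gcongr
  rcases le_total a b with h | h
  · rw [max_eq_right h]
    exact le_add_self
  · rw [max_eq_left h]
    exact le_self_add

/-! ### Weighted norms. -/

theorem weightedNorm_eq_lintegral_enorm {N : ℕ} {s : ℝ} (hs : 0 ≤ s)
    (W u : EuclideanSpace ℝ (Fin N) → ℝ) :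
    weightedNorm s W u = (∫⁻ x, ‖u x‖ₑ ^ s * ENNReal.ofReal (W x)) ^ (1 / s) := by
  unfold weightedNorm
  congr 1
  refine lintegral_congr fun x => ?_
  rw [ENNReal.ofReal_mul (by positivity), ← Real.enorm_abs, Real.enorm_of_nonneg (abs_nonneg _),
    ENNReal.ofReal_rpow_of_nonneg (abs_nonneg _) hs]

theorem lintegral_le_of_weightedNorm_le {N : ℕ} {s : ℝ} (hs : 0 < s)
    {W u : EuclideanSpace ℝ (Fin N) → ℝ} {C : ℝ≥0∞} (h : weightedNorm s W u ≤ C) :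
    ∫⁻ x, ‖u x‖ₑ ^ s * ENNReal.ofReal (W x) ≤ C ^ s := by
  rwa [weightedNorm_eq_lintegral_enorm hs.le, one_div, ENNReal.rpow_inv_le_iff hs] at h

/-- On `D`, `|u| ≤ 1 + |u|^q` and `1 ≤ V/c`. Vector values and the weight `1` also cover gradients.
-/
theorem lintegral_enorm_le_of_weight_ge {N : ℕ} {F : Type*} [NormedAddCommGroup F]
    {q c : ℝ} (hq : 1 ≤ q) (hc : 0 < c)
    {V : EuclideanSpace ℝ (Fin N) → ℝ} {u : EuclideanSpace ℝ (Fin N) → F}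
    {D : Set (EuclideanSpace ℝ (Fin N))} (hD : MeasurableSet D) (hV : ∀ x ∈ D, c ≤ V x) :
    ∫⁻ x in D, ‖u x‖ₑ ≤ volume D +
      (ENNReal.ofReal c)⁻¹ * ∫⁻ x, ‖u x‖ₑ ^ q * ENNReal.ofReal (V x) := by
  have hc0 : ENNReal.ofReal c ≠ 0 := by simpa using hc
  calc ∫⁻ x in D, ‖u x‖ₑ
      ≤ ∫⁻ x in D, (1 + (ENNReal.ofReal c)⁻¹ * (‖u x‖ₑ ^ q * ENNReal.ofReal (V x))) := by
        refine setLIntegral_mono' hD fun x hx => ?_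
        refine (ENNReal.le_one_add_rpow hq _).trans ?_
        gcongr
        rw [mul_left_comm]
        refine le_mul_of_one_le_right zero_le ?_
        rw [← ENNReal.inv_mul_cancel hc0 ENNReal.ofReal_ne_top]
        gcongr
        exact hV x hx
    _ = volume D + (ENNReal.ofReal c)⁻¹ *
          ∫⁻ x in D, ‖u x‖ₑ ^ q * ENNReal.ofReal (V x) := by
        rw [lintegral_add_left' aemeasurable_const, setLIntegral_one,
          lintegral_const_mul' _ _ (ENNReal.inv_ne_top.2 hc0)]
    _ ≤ _ := by
        gcongr
        exact Measure.restrict_le_self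

theorem enorm_rpow_mul_eq_mul_weight {x k v q r : ℝ} (hq : 0 < q) (hr : 0 ≤ r) (hk : 0 ≤ k)
    (hv : 0 < v) :
    ‖x‖ₑ ^ r * ENNReal.ofReal k =
      (‖x‖ₑ ^ q * ENNReal.ofReal v) ^ (r / q) * ENNReal.ofReal (k * v ^ (-(r / q))) := by
  have h0 : 0 ≤ r / q := by positivity
  rw [ENNReal.mul_rpow_of_nonneg _ _ h0, ← ENNReal.rpow_mul, mul_div_cancel₀ _ hq.ne',
    ENNReal.ofReal_mul hk, ENNReal.ofReal_rpow_of_pos hv, mul_assoc]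
  congr 1
  rw [mul_left_comm, ← ENNReal.ofReal_mul (by positivity), ← Real.rpow_add hv, add_neg_cancel,
    Real.rpow_zero, ENNReal.ofReal_one, mul_one]

theorem ofReal_mul_rpow_rpow_eq {k v q r : ℝ} (hq : 0 < q) (hrq : r < q) (hk : 0 < k)
    (hv : 0 < v) :
    ENNReal.ofReal (k * v ^ (-(r / q))) ^ (q / (q - r)) =
      ENNReal.ofReal (k ^ (q / (q - r)) * v ^ (-(r / (q - r)))) := by
  have h := sub_pos.2 hrq
  rw [ENNReal.ofReal_rpow_of_pos (by positivity), Real.mul_rpow hk.le (by positivity),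
    ← Real.rpow_mul hv.le]
  congr 3
  field_simp

theorem holderConjugate_div_sub {q r : ℝ} (hr : 0 < r) (hrq : r < q) :
    (q / r).HolderConjugate (q / (q - r)) := by
  have h := sub_pos.2 hrq
  rw [Real.holderConjugate_iff]
  refine ⟨(one_lt_div hr).2 hrq, ?_⟩
  have : 0 < q := hr.trans hrq
  field_simp
  ring

theorem hasWeakGradient_weakGradient {N : ℕ} {p : ℝ} {u : EuclideanSpace ℝ (Fin N) → ℝ}
    (hu : u ∈ homogeneousSobolev N p) : HasWeakGradient u (weakGradient u) := by
  obtain ⟨-, g, hg, -⟩ := hu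
  have h : ∃ g, HasWeakGradient u g := ⟨g, hg⟩
  rw [weakGradient, dif_pos h]
  exact h.choose_spec

theorem one_le_sobolevCritical {N : ℕ} {p : ℝ} (hp : 1 ≤ p) (hpN : p < N) :
    1 ≤ sobolevCritical N p := by
  have h : 0 < (N : ℝ) - p := sub_pos.2 hpN
  rw [sobolevCritical, one_le_div h]
  nlinarith [(Nat.cast_nonneg N : (0 : ℝ) ≤ N)]

theorem lintegral_weight_rpow_ne_top {N : ℕ} {q r : ℝ} (hr : 0 < r) (hrq : r < q)
    {K V : EuclideanSpace ℝ (Fin N) → ℝ} (hK : ∀ x, 0 < K x) (hV : ∀ x, 0 < V x)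
    (hKV : Integrable (fun x => K x ^ (q / (q - r)) * V x ^ (-(r / (q - r)))) volume) :
    ∫⁻ x, ENNReal.ofReal (K x * V x ^ (-(r / q))) ^ (q / (q - r)) ≠ ⊤ := by
  simp only [ofReal_mul_rpow_rpow_eq (hr.trans hrq) hrq (hK _) (hV _)]
  exact hKV.lintegral_lt_top.ne

/-- Hölder's inequality between weighted norms. -/
theorem weightedNorm_le_mul_weightedNorm {N : ℕ} {q r : ℝ} (hr : 0 < r) (hrq : r < q)
    {K V u : EuclideanSpace ℝ (Fin N) → ℝ} (hKm : AEMeasurable K) (hVm : AEMeasurable V)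
    (hK : ∀ x, 0 < K x) (hV : ∀ x, 0 < V x) (hu : AEMeasurable u) :
    weightedNorm r K u ≤
      ((∫⁻ x, ENNReal.ofReal (K x * V x ^ (-(r / q))) ^ (q / (q - r))) ^
        (1 / (q / (q - r)))) ^ (1 / r) * weightedNorm q V u := by
  have hq : 0 < q := hr.trans hrq
  have hst := holderConjugate_div_sub hr hrq
  rw [weightedNorm_eq_lintegral_enorm hr.le, weightedNorm_eq_lintegral_enorm hq.le]
  simp only [fun x => enorm_rpow_mul_eq_mul_weight (x := u x) hq hr.le (hK x).le (hV x)]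
  have h1 := ENNReal.lintegral_mul_le_Lp_mul_Lq (volume : Measure (EuclideanSpace ℝ (Fin N))) hst
    (f := fun x => (‖u x‖ₑ ^ q * ENNReal.ofReal (V x)) ^ (r / q))
    (g := fun x => ENNReal.ofReal (K x * V x ^ (-(r / q)))) (by fun_prop) (by fun_prop)
  refine (ENNReal.rpow_le_rpow h1 (by positivity)).trans_eq ?_
  have h2 : r / q * (q / r) = 1 := by field_simp
  simp only [← ENNReal.rpow_mul, h2, ENNReal.rpow_one]
  rw [ENNReal.mul_rpow_of_nonneg _ _ (by positivity), mul_comm, ← ENNReal.rpow_mul,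
    ← ENNReal.rpow_mul]
  congr 2
  field_simp

theorem locallyIntegrable_of_weightedNorm_lt_top {N : ℕ} {q : ℝ} (hq : 1 ≤ q)
    {V u : EuclideanSpace ℝ (Fin N) → ℝ}
    (hVloc : ∀ D : Set (EuclideanSpace ℝ (Fin N)), IsCompact D →
      ∃ VD : ℝ, 0 < VD ∧ ∀ x ∈ D, VD ≤ V x)
    (hu : AEStronglyMeasurable u) (hfin : weightedNorm q V u < ⊤) :
    LocallyIntegrable u volume := by
  rw [locallyIntegrable_iff]
  intro D hD
  obtain ⟨c, hc, hcV⟩ := hVloc D hD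
  refine ⟨hu.restrict, ?_⟩
  have hq0 : 0 < q := zero_lt_one.trans_le hq
  refine (lintegral_enorm_le_of_weight_ge (u := u) hq hc hD.measurableSet hcV).trans_lt ?_
  refine ENNReal.add_lt_top.2 ⟨hD.measure_lt_top, ENNReal.mul_lt_top
    (ENNReal.inv_lt_top.2 (ENNReal.ofReal_pos.2 hc)) ?_⟩
  exact (lintegral_le_of_weightedNorm_le hq0 le_rfl).trans_lt
    (ENNReal.rpow_lt_top_of_nonneg hq0.le hfin.ne)

/-- A sequence bounded in `L^q_V` that converges a.e. converges in `L^r_K`. -/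
theorem tendsto_weightedNorm_sub_of_ae_tendsto {N : ℕ} {q r : ℝ} (hr : 0 < r) (hrq : r < q)
    {K V w : EuclideanSpace ℝ (Fin N) → ℝ} (hKm : AEMeasurable K) (hVm : AEMeasurable V)
    (hK : ∀ x, 0 < K x) (hV : ∀ x, 0 < V x)
    (hKV : Integrable (fun x => K x ^ (q / (q - r)) * V x ^ (-(r / (q - r)))) volume)
    {u : ℕ → EuclideanSpace ℝ (Fin N) → ℝ} (hu : ∀ n, AEMeasurable (u n)) (hw : AEMeasurable w)
    {C : ℝ≥0∞} (hC : C ≠ ⊤) (huC : ∀ n, weightedNorm q V (u n) ≤ C) (hwC : weightedNorm q V w ≤ C)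
    (hlim : ∀ᵐ x, Tendsto (fun n => u n x) atTop (𝓝 (w x))) :
    Tendsto (fun n => weightedNorm r K (fun x => u n x - w x)) atTop (𝓝 0) := by
  have hq : 0 < q := hr.trans hrq
  have hst := holderConjugate_div_sub hr hrq
  simp only [weightedNorm_eq_lintegral_enorm hr.le,
    fun n x => enorm_rpow_mul_eq_mul_weight (x := u n x - w x) hq hr.le (hK x).le (hV x)]
  have h2 : r / q * (q / r) = 1 := by field_simp
  -- The bound comes from `|u - w|^q ≤ 2^q (|u|^q + |w|^q)`.
  have key := tendsto_lintegral_mul_zero_of_bounded (μ := volume) hst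
    (a := fun n x => (‖u n x - w x‖ₑ ^ q * ENNReal.ofReal (V x)) ^ (r / q))
    (b := fun x => ENNReal.ofReal (K x * V x ^ (-(r / q))))
    (C := 2 ^ q * (C ^ q + C ^ q)) (fun n => by have := hu n; fun_prop) (by fun_prop)
    (by finiteness) (fun n => ?_) (lintegral_weight_rpow_ne_top hr hrq hK hV hKV) ?_
  · have h3 := key.ennrpow_const (1 / r)
    rwa [ENNReal.zero_rpow_of_pos (by positivity)] at h3
  · simp only [← ENNReal.rpow_mul, h2, ENNReal.rpow_one]
    have hun := hu n
    calc ∫⁻ x, ‖u n x - w x‖ₑ ^ q * ENNReal.ofReal (V x)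
        ≤ ∫⁻ x, 2 ^ q * (‖u n x‖ₑ ^ q * ENNReal.ofReal (V x) +
            ‖w x‖ₑ ^ q * ENNReal.ofReal (V x)) := by
          refine lintegral_mono fun x => ?_
          rw [← add_mul, ← mul_assoc]
          gcongr
          exact (ENNReal.rpow_le_rpow enorm_sub_le hq.le).trans
            (ENNReal.add_rpow_le_two_rpow_mul hq.le _ _)
      _ = 2 ^ q * ((∫⁻ x, ‖u n x‖ₑ ^ q * ENNReal.ofReal (V x)) +
            ∫⁻ x, ‖w x‖ₑ ^ q * ENNReal.ofReal (V x)) := by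
          rw [lintegral_const_mul' _ _ (by finiteness), lintegral_add_left' (by fun_prop)]
      _ ≤ _ := by
          gcongr
          · exact lintegral_le_of_weightedNorm_le hq (huC n)
          · exact lintegral_le_of_weightedNorm_le hq hwC
  · filter_upwards [hlim] with x hx
    have h4 : Tendsto (fun n => ‖u n x - w x‖ₑ) atTop (𝓝 0) := by
      simpa using (hx.sub_const (w x)).enorm
    have h5 := h4.ennrpow_const q
    rw [ENNReal.zero_rpow_of_pos hq] at h5
    have h6 := (ENNReal.Tendsto.mul_const h5 (b := ENNReal.ofReal (V x))
      (Or.inr ENNReal.ofReal_ne_top)).ennrpow_const (r / q)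
    rwa [zero_mul, ENNReal.zero_rpow_of_pos (by positivity)] at h6

theorem weightedNorm_le_of_ae_tendsto {N : ℕ} {q : ℝ} (hq : 0 < q)
    {V w : EuclideanSpace ℝ (Fin N) → ℝ} (hVm : AEMeasurable V)
    {u : ℕ → EuclideanSpace ℝ (Fin N) → ℝ} (hu : ∀ n, AEMeasurable (u n))
    {C : ℝ≥0∞} (huC : ∀ n, weightedNorm q V (u n) ≤ C)
    (hlim : ∀ᵐ x, Tendsto (fun n => u n x) atTop (𝓝 (w x))) : weightedNorm q V w ≤ C := by
  rw [weightedNorm_eq_lintegral_enorm hq.le, one_div, ENNReal.rpow_inv_le_iff hq]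
  have h1 : ∀ᵐ x, Tendsto (fun n => ‖u n x‖ₑ ^ q * ENNReal.ofReal (V x)) atTop
      (𝓝 (‖w x‖ₑ ^ q * ENNReal.ofReal (V x))) := by
    filter_upwards [hlim] with x hx
    exact ENNReal.Tendsto.mul_const (hx.enorm.ennrpow_const q) (Or.inr ENNReal.ofReal_ne_top)
  calc _ = ∫⁻ x, liminf (fun n => ‖u n x‖ₑ ^ q * ENNReal.ofReal (V x)) atTop := by
        refine lintegral_congr_ae ?_
        filter_upwards [h1] with x hx using hx.liminf_eq.symm
    _ ≤ liminf (fun n => ∫⁻ x, ‖u n x‖ₑ ^ q * ENNReal.ofReal (V x)) atTop :=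
        lintegral_liminf_le' fun n => by have := hu n; fun_prop
    _ ≤ _ := by
        refine liminf_le_of_le (by isBoundedDefault) fun b hb => ?_
        obtain ⟨n, hn⟩ := hb.exists
        exact hn.trans (lintegral_le_of_weightedNorm_le hq (huC n))

theorem lintegral_ball_enorm_le_of_eLpNorm_le {N : ℕ} {F : Type*} [NormedAddCommGroup F] {p : ℝ}
    (hp : 1 ≤ p) {g : EuclideanSpace ℝ (Fin N) → F} {C : ℝ≥0∞}
    (hg : eLpNorm g (ENNReal.ofReal p) volume ≤ C) (R : ℝ) :
    ∫⁻ x in Metric.ball 0 R, ‖g x‖ₑ ≤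
      volume (Metric.ball (0 : EuclideanSpace ℝ (Fin N)) R) + C ^ p := by
  have hp0 : 0 < p := zero_lt_one.trans_le hp
  have h := lintegral_enorm_le_of_weight_ge (u := g) (V := fun _ => 1) hp one_pos
    (D := Metric.ball 0 R) Metric.isOpen_ball.measurableSet (fun _ _ => le_rfl)
  rw [eLpNorm_eq_lintegral_rpow_enorm_toReal (by simpa using hp0) ENNReal.ofReal_ne_top,
    ENNReal.toReal_ofReal hp0.le, one_div, ENNReal.rpow_inv_le_iff hp0] at hg
  simp only [ENNReal.ofReal_one, inv_one, mul_one, one_mul] at h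
  exact h.trans (by gcongr)

/-! ### The compact embedding. -/

theorem proposition2p4 (N : ℕ) (p q r : ℝ) (α : ℝ≥0∞)
    (K V : EuclideanSpace ℝ (Fin N) → ℝ)
    (hp : 1 ≤ p) (hpN : p < N)
    (hr : sobolevCritical N p ≤ r) (hrq : r < q)
    (hKmeas : AEMeasurable K volume) (hVmeas : AEMeasurable V volume)
    (hKpos : ∀ x, 0 < K x) (hVpos : ∀ x, 0 < V x)
    (hα : ENNReal.ofReal (q / (q - r)) < α)
    (hKloc : ∀ D : Set (EuclideanSpace ℝ (Fin N)), IsCompact D → MemLp K α (volume.restrict D))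
    (hVloc : ∀ D : Set (EuclideanSpace ℝ (Fin N)), IsCompact D →
      ∃ VD : ℝ, 0 < VD ∧ ∀ x ∈ D, VD ≤ V x)
    (hKV : Integrable (fun x => K x ^ (q / (q - r)) * V x ^ (-(r / (q - r)))) volume) :
    IsCompactEmbedding (sobolevM p q V) (sobolevMNorm p q V)
      (weightedLp r K) (weightedNorm r K) := by
  have hr1 : 1 ≤ r := (one_le_sobolevCritical hp hpN).trans hr
  have hr0 : 0 < r := zero_lt_one.trans_le hr1
  have hq1 : 1 ≤ q := hr1.trans hrq.le
  have hq0 : 0 < q := zero_lt_one.trans_le hq1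
  -- The Hölder constant: the `L^(q/(q-r))` norm of `K V^(-r/q)`, to the power `1/r`.
  set B : ℝ≥0∞ := ((∫⁻ x, ENNReal.ofReal (K x * V x ^ (-(r / q))) ^ (q / (q - r))) ^
    (1 / (q / (q - r)))) ^ (1 / r)
  have hB : B ≠ ⊤ := by
    have h1 : 0 ≤ 1 / (q / (q - r)) :=
      one_div_nonneg.2 (holderConjugate_div_sub hr0 hrq).symm.nonneg
    exact ENNReal.rpow_ne_top_of_nonneg (by positivity) (ENNReal.rpow_ne_top_of_nonneg h1
      (lintegral_weight_rpow_ne_top hr0 hrq hKpos hVpos hKV))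
  have hbound : ∀ u ∈ weightedLp q V, weightedNorm r K u ≤ B * weightedNorm q V u :=
    fun u hu => weightedNorm_le_mul_weightedNorm hr0 hrq hKmeas hVmeas hKpos hVpos
      hu.1.aestronglyMeasurable.aemeasurable
  have hsub : weightedLp q V ⊆ weightedLp r K := fun u hu =>
    ⟨hu.1, (hbound u hu).trans_lt (ENNReal.mul_lt_top hB.lt_top hu.2)⟩
  refine ⟨fun u hu => hsub hu.2, ⟨B.toNNReal, fun u hu => ?_⟩, fun u hu hC => ?_⟩
  · rw [ENNReal.coe_toNNReal hB]
    exact (hbound u hu.2).trans (mul_le_mul' le_rfl le_self_add)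
  · obtain ⟨C, hC⟩ := hC
    have huC : ∀ n, weightedNorm q V (u n) ≤ C := fun n => le_self_add.trans (hC n)
    have hgC : ∀ n, eLpNorm (weakGradient (u n)) (ENNReal.ofReal p) volume ≤ C := fun n =>
      le_add_self.trans (hC n)
    have hum : ∀ n, AEMeasurable (u n) := fun n =>
      (hu n).2.1.aestronglyMeasurable.aemeasurable
    have hu1 : ∀ R : ℝ, ∃ A : ℝ≥0, ∀ n, ∫⁻ x in Metric.ball 0 R, ‖u n x‖ₑ ≤ A := by
      intro R
      obtain ⟨c, hc, hcV⟩ := hVloc (Metric.closedBall 0 R) (isCompact_closedBall 0 R)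
      have hfin : volume (Metric.ball (0 : EuclideanSpace ℝ (Fin N)) R) +
          (ENNReal.ofReal c)⁻¹ * (C : ℝ≥0∞) ^ q ≠ ⊤ :=
        ENNReal.add_ne_top.2 ⟨measure_ball_lt_top.ne, ENNReal.mul_ne_top
          (ENNReal.inv_ne_top.2 (ENNReal.ofReal_pos.2 hc).ne') (by finiteness)⟩
      refine ⟨_, fun n => le_trans ?_ (ENNReal.coe_toNNReal hfin).ge⟩
      refine (lintegral_enorm_le_of_weight_ge (u := u n) hq1 hc Metric.isOpen_ball.measurableSet
        fun x hx => hcV x (Metric.ball_subset_closedBall hx)).trans ?_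
      gcongr
      exact lintegral_le_of_weightedNorm_le hq0 (huC n)
    have hg1 : ∀ R : ℝ, ∃ A : ℝ≥0, ∀ n,
        ∫⁻ x in Metric.ball 0 R, ‖weakGradient (u n) x‖ₑ ≤ A := by
      intro R
      have hfin : volume (Metric.ball (0 : EuclideanSpace ℝ (Fin N)) R) +
          (C : ℝ≥0∞) ^ p ≠ ⊤ :=
        ENNReal.add_ne_top.2 ⟨measure_ball_lt_top.ne, by finiteness⟩
      refine ⟨_, fun n => le_trans ?_ (ENNReal.coe_toNNReal hfin).ge⟩
      exact lintegral_ball_enorm_le_of_eLpNorm_le hp (hgC n) R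
    obtain ⟨s, hs, w, hw, hlim⟩ := exists_subseq_ae_tendsto_of_hasWeakGradient
      (fun n => hasWeakGradient_weakGradient (hu n).1) hu1 hg1
    -- By Fatou `w` inherits the bound `C`; with the local lower bounds on `V` this makes `w`
    -- locally integrable, as membership in the target space requires.
    have hwC : weightedNorm q V w ≤ C :=
      weightedNorm_le_of_ae_tendsto hq0 hVmeas (fun n => hum (s n)) (fun n => huC (s n)) hlim
    have hwfin : weightedNorm q V w < ⊤ := hwC.trans_lt ENNReal.coe_lt_top
    exact ⟨w, hsub ⟨locallyIntegrable_of_weightedNorm_lt_top hq1 hVloc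
      hw.aestronglyMeasurable hwfin, hwfin⟩, s, hs,
      tendsto_weightedNorm_sub_of_ae_tendsto hr0 hrq hKmeas hVmeas hKpos hVpos hKV
        (fun n => hum (s n)) hw.aemeasurable ENNReal.coe_ne_top (fun n => huC (s n)) hwC hlim⟩
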